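/- For $p\in(1,\infty)$, let $J_p$ be the (real) James sequence space \[ J_p=\Big\{x=(x(n))_n\in\mathbb{R}^{\mathbb N} : \lim_n x(n)=0,\ \|x\|_{J_p}=\sup_{p_1<\dots<p_n}\Big(\sum_{i=2}^{n}|x(p_i)-x(p_{i-1})|^p\Big)^{1/p}<\infty\Big\}, \] a Banach space with the norm $\|\cdot\|_{J_p}$. A map $f\colon X\to Y$ between Banach spaces is called \emph{coarse} if for every $t\ge 0$ \[ \sup\{\|f(x)-f(z)\| : x,z\in X,\ \|x-z\|\le t\}<\infty, \] and, for $\alpha\in[0,1]$, it is called \emph{linearly expanding at rate $\alpha$} if for every $L>0$ there is $C>0$ such that for all $x,z\in X$, \[ \|x-z\|\ge L\max\{\|x\|^\alpha,\|z\|^\alpha\}+L\quad\text{implies}\quad \|f(x)-f(z)\|\ge \frac{1}{C}\|x-z\|-C . \] Let $p,q\in(1,\infty)$ with $p>q$. Then there is no coarse map from $J_p$ to $J_q$ that is linearly expanding at rate $1$. -/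

import Mathlib

open Filter Topology

/-- A map `f` between metric spaces is coarse if
`ω_f(t) = sup {d(f x, f z) | d(x, z) ≤ t}` is finite for every `t ≥ 0`. -/
def IsCoarseMap {X Y : Type*} [PseudoMetricSpace X] [PseudoMetricSpace Y] (f : X → Y) : Prop :=
  ∀ t : ℝ, 0 ≤ t → BddAbove {r : ℝ | ∃ x z : X, dist x z ≤ t ∧ r = dist (f x) (f z)}

/-- `f` is linearly expanding at rate `α`: for every `L > 0` there is `C > 0` such that
`‖x - z‖ ≥ L max {‖x‖^α, ‖z‖^α} + L` implies `‖f x - f z‖ ≥ ‖x - z‖ / C - C`. -/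
def IsLinearlyExpandingAtRate {X Y : Type*} [NormedAddCommGroup X] [NormedAddCommGroup Y]
    (α : ℝ) (f : X → Y) : Prop :=
  ∀ L : ℝ, 0 < L → ∃ C : ℝ, 0 < C ∧ ∀ x z : X,
    L * max (‖x‖ ^ α) (‖z‖ ^ α) + L ≤ ‖x - z‖ → ‖x - z‖ / C - C ≤ ‖f x - f z‖

namespace James

/-- The `p`-variation of `x` along `k 0 < k 1 < ⋯ < k n`. -/
noncomputable def pVar (p : ℝ) (k : ℕ → ℕ) (n : ℕ) (x : ℕ → ℝ) : ℝ :=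
  (∑ i ∈ Finset.range n, |x (k (i + 1)) - x (k i)| ^ p) ^ (1 / p)

/-- All `p`-variations of `x` along finite strictly increasing sequences of indices (each such
sequence is an initial segment of a strictly increasing `k : ℕ → ℕ`). -/
def pVarSet (p : ℝ) (x : ℕ → ℝ) : Set ℝ :=
  {r | ∃ (k : ℕ → ℕ) (n : ℕ), StrictMono k ∧ r = pVar p k n x}

/-- Null sequences of finite `p`-variation. -/
def Mem (p : ℝ) (x : ℕ → ℝ) : Prop :=
  Tendsto x atTop (𝓝 0) ∧ BddAbove (pVarSet p x)

/-- The James norm. -/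
noncomputable def jnorm (p : ℝ) (x : ℕ → ℝ) : ℝ := sSup (pVarSet p x)

theorem pVar_nonneg (p : ℝ) (k : ℕ → ℕ) (n : ℕ) (x : ℕ → ℝ) : 0 ≤ pVar p k n x :=
  Real.rpow_nonneg (Finset.sum_nonneg fun _ _ => Real.rpow_nonneg (abs_nonneg _) _) _

theorem pVar_add_le {p : ℝ} (hp : 1 < p) (k : ℕ → ℕ) (n : ℕ) (x y : ℕ → ℝ) :
    pVar p k n (x + y) ≤ pVar p k n x + pVar p k n y := by
  have h := Real.Lp_add_le (Finset.range n) (fun i => x (k (i + 1)) - x (k i))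
    (fun i => y (k (i + 1)) - y (k i)) hp.le
  unfold pVar
  refine le_trans (le_of_eq ?_) h
  congr 1
  refine Finset.sum_congr rfl fun i _ => ?_
  congr 2
  simp only [Pi.add_apply]
  ring

theorem pVar_smul {p : ℝ} (hp : 1 < p) (k : ℕ → ℕ) (n : ℕ) (c : ℝ) (x : ℕ → ℝ) :
    pVar p k n (c • x) = |c| * pVar p k n x := by
  unfold pVar
  have h : ∀ i, |(c • x) (k (i + 1)) - (c • x) (k i)| ^ p
      = |c| ^ p * |x (k (i + 1)) - x (k i)| ^ p := fun i => by
    rw [← Real.mul_rpow (abs_nonneg _) (abs_nonneg _), ← abs_mul]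
    simp [mul_sub]
  simp only [h]
  rw [← Finset.mul_sum, Real.mul_rpow (Real.rpow_nonneg (abs_nonneg _) _)
    (Finset.sum_nonneg fun _ _ => Real.rpow_nonneg (abs_nonneg _) _), ← Real.rpow_mul (abs_nonneg _),
    mul_one_div_cancel (by linarith), Real.rpow_one]

theorem zero_mem_pVarSet {p : ℝ} (hp : 1 < p) (x : ℕ → ℝ) : (0 : ℝ) ∈ pVarSet p x := by
  refine ⟨id, 0, strictMono_id, ?_⟩
  have : p ≠ 0 := by linarith
  simp [pVar, this]

theorem pVar_le_jnorm {p : ℝ} {x : ℕ → ℝ} (hx : Mem p x) {k : ℕ → ℕ} (hk : StrictMono k) (n : ℕ) :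
    pVar p k n x ≤ jnorm p x :=
  le_csSup hx.2 ⟨k, n, hk, rfl⟩

theorem jnorm_le {p : ℝ} (hp : 1 < p) {x : ℕ → ℝ} {B : ℝ}
    (h : ∀ k n, StrictMono k → pVar p k n x ≤ B) : jnorm p x ≤ B :=
  csSup_le ⟨0, zero_mem_pVarSet hp x⟩ (by rintro _ ⟨k, n, hk, rfl⟩; exact h k n hk)

theorem jnorm_nonneg {p : ℝ} (x : ℕ → ℝ) : 0 ≤ jnorm p x :=
  Real.sSup_nonneg (by rintro _ ⟨k, n, -, rfl⟩; exact pVar_nonneg _ _ _ _)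

theorem abs_le_jnorm {p : ℝ} (hp : 1 < p) {x : ℕ → ℝ} (hx : Mem p x) (a : ℕ) :
    |x a| ≤ jnorm p x := by
  have h1 : ∀ b, a < b → |x b - x a| ≤ jnorm p x := fun b hb => by
    have hk : StrictMono (fun i : ℕ => a + i * (b - a)) := fun i j hij => by
      have : 0 < b - a := by omega
      exact Nat.add_lt_add_left (Nat.mul_lt_mul_of_pos_right hij this) a
    have h := pVar_le_jnorm hx hk 1
    have h2 : a + (b - a) = b := by omega
    simp only [pVar, Finset.sum_range_one, zero_add, one_mul, zero_mul, add_zero, h2] at h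
    rwa [← Real.rpow_mul (abs_nonneg _), mul_one_div_cancel (by linarith), Real.rpow_one] at h
  have h2 : Tendsto (fun b => |x b - x a|) atTop (𝓝 |0 - x a|) := (hx.1.sub_const _).abs
  rw [zero_sub, abs_neg] at h2
  exact le_of_tendsto h2 ((eventually_gt_atTop a).mono h1)

theorem Mem.add {p : ℝ} (hp : 1 < p) {x y : ℕ → ℝ} (hx : Mem p x) (hy : Mem p y) :
    Mem p (x + y) := by
  refine ⟨by have h := hx.1.add hy.1; rw [add_zero] at h; exact h, jnorm p x + jnorm p y, ?_⟩
  rintro _ ⟨k, n, hk, rfl⟩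
  exact (pVar_add_le hp k n x y).trans (add_le_add (pVar_le_jnorm hx hk n) (pVar_le_jnorm hy hk n))

theorem Mem.smul {p : ℝ} (hp : 1 < p) {x : ℕ → ℝ} (c : ℝ) (hx : Mem p x) : Mem p (c • x) := by
  refine ⟨by have h := hx.1.const_smul c; rw [smul_zero] at h; exact h, |c| * jnorm p x, ?_⟩
  rintro _ ⟨k, n, hk, rfl⟩
  rw [pVar_smul hp]
  exact mul_le_mul_of_nonneg_left (pVar_le_jnorm hx hk n) (abs_nonneg _)

theorem Mem.zero {p : ℝ} (hp : 1 < p) : Mem p 0 := by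
  refine ⟨tendsto_const_nhds, 0, ?_⟩
  rintro _ ⟨k, n, -, rfl⟩
  have := pVar_smul hp k n 0 (0 : ℕ → ℝ)
  simp at this
  exact this.le

/-- The vector space of null sequences of finite `p`-variation. -/
def submodule (p : ℝ) [hp : Fact (1 < p)] : Submodule ℝ (ℕ → ℝ) where
  carrier := {x | Mem p x}
  add_mem' := fun hx hy => Mem.add hp.out hx hy
  zero_mem' := Mem.zero hp.out
  smul_mem' := fun c _ hx => Mem.smul hp.out c hx

end James

/-- The James space `J_p`: null sequences of finite `p`-variation with the James norm (a type
synonym, so that it does not inherit the product topology). -/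
def JamesSpace (p : ℝ) [Fact (1 < p)] : Type := James.submodule p

namespace JamesSpace

variable {p : ℝ} [hp : Fact (1 < p)]

instance : AddCommGroup (JamesSpace p) := inferInstanceAs (AddCommGroup (James.submodule p))

instance : Module ℝ (JamesSpace p) := inferInstanceAs (Module ℝ (James.submodule p))

/-- The underlying sequence. -/
def toSeq (x : JamesSpace p) : ℕ → ℝ := x.1

theorem mem (x : JamesSpace p) : James.Mem p x.toSeq := x.2

theorem toSeq_add (x y : JamesSpace p) : (x + y).toSeq = x.toSeq + y.toSeq := rfl

theorem toSeq_sub (x y : JamesSpace p) : (x - y).toSeq = x.toSeq - y.toSeq := rfl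

theorem toSeq_smul (c : ℝ) (x : JamesSpace p) : (c • x).toSeq = c • x.toSeq := rfl

theorem toSeq_zero : (0 : JamesSpace p).toSeq = 0 := rfl

theorem toSeq_injective : Function.Injective (toSeq (p := p)) := Subtype.val_injective

noncomputable instance : Norm (JamesSpace p) := ⟨fun x => James.jnorm p x.toSeq⟩

theorem norm_def (x : JamesSpace p) : ‖x‖ = James.jnorm p x.toSeq := rfl

theorem core : NormedSpace.Core ℝ (JamesSpace p) where
  norm_nonneg x := James.jnorm_nonneg _
  norm_smul c x := by
    have h : ∀ (c : ℝ) (x : JamesSpace p), ‖c • x‖ ≤ |c| * ‖x‖ := fun c x => by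
      rw [norm_def, norm_def, toSeq_smul]
      refine James.jnorm_le hp.out fun k n hk => ?_
      rw [James.pVar_smul hp.out]
      exact mul_le_mul_of_nonneg_left (James.pVar_le_jnorm x.mem hk n) (abs_nonneg _)
    refine le_antisymm (h c x) ?_
    rw [Real.norm_eq_abs]
    rcases eq_or_ne c 0 with rfl | hc
    · rw [abs_zero, zero_mul]
      exact James.jnorm_nonneg _
    · have h2 := h c⁻¹ (c • x)
      rw [inv_smul_smul₀ hc, abs_inv] at h2
      have h3 : 0 < |c| := abs_pos.mpr hc
      calc |c| * ‖x‖ ≤ |c| * (|c|⁻¹ * ‖c • x‖) := mul_le_mul_of_nonneg_left h2 h3.le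
        _ = ‖c • x‖ := by field_simp
  norm_triangle x y := by
    rw [norm_def, norm_def, norm_def, toSeq_add]
    exact James.jnorm_le hp.out fun k n hk => (James.pVar_add_le hp.out k n _ _).trans
      (add_le_add (James.pVar_le_jnorm x.mem hk n) (James.pVar_le_jnorm y.mem hk n))
  norm_eq_zero_iff x := by
    constructor
    · intro h
      apply toSeq_injective
      funext a
      have h2 := James.abs_le_jnorm hp.out x.mem a
      rw [← norm_def, h] at h2
      simpa [toSeq_zero] using h2
    · rintro rfl
      refine le_antisymm (James.jnorm_le hp.out fun k n _ => ?_) (James.jnorm_nonneg _)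
      have := James.pVar_smul hp.out k n 0 (0 : ℕ → ℝ)
      rw [zero_smul, abs_zero, zero_mul] at this
      exact this.le

noncomputable instance : NormedAddCommGroup (JamesSpace p) := NormedAddCommGroup.ofCore core

noncomputable instance : NormedSpace ℝ (JamesSpace p) := NormedSpace.ofCore core

theorem norm_eq (x : JamesSpace p) : ‖x‖ = James.jnorm p x.toSeq := rfl

theorem abs_apply_le (x : JamesSpace p) (a : ℕ) : |x.toSeq a| ≤ ‖x‖ :=
  James.abs_le_jnorm hp.out x.mem a

/-- `J_p` is a Banach space. -/
instance : CompleteSpace (JamesSpace p) := by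
  refine Metric.complete_of_cauchySeq_tendsto fun u hu => ?_
  have hc : ∀ a, ∃ l, Tendsto (fun n => (u n).toSeq a) atTop (𝓝 l) := fun a => by
    refine cauchySeq_tendsto_of_complete (Metric.cauchySeq_iff.2 fun ε hε => ?_)
    obtain ⟨N, hN⟩ := Metric.cauchySeq_iff.1 hu ε hε
    refine ⟨N, fun m hm n hn => lt_of_le_of_lt ?_ (hN m hm n hn)⟩
    rw [dist_eq_norm (u m), Real.dist_eq]
    exact abs_apply_le (u m - u n) a
  choose y hy using hc
  -- uniform control of the differences
  have key : ∀ ε > 0, ∃ N, ∀ m ≥ N, (∀ a, |(u m).toSeq a - y a| ≤ ε) ∧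
      ∀ k n, StrictMono k → James.pVar p k n (y - (u m).toSeq) ≤ ε := fun ε hε => by
    obtain ⟨N, hN⟩ := Metric.cauchySeq_iff.1 hu ε hε
    refine ⟨N, fun m hm => ⟨fun a => ?_, fun k n hk => ?_⟩⟩
    · refine le_of_tendsto ((hy a).const_sub _).abs ((eventually_ge_atTop N).mono fun j hj => ?_)
      refine (abs_apply_le (u m - u j) a).trans ?_
      rw [← dist_eq_norm]
      exact (hN m hm j hj).le
    · have ht : Tendsto (fun j => James.pVar p k n ((u j).toSeq - (u m).toSeq)) atTop
          (𝓝 (James.pVar p k n (y - (u m).toSeq))) := by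
        unfold James.pVar
        have hp0 : 0 < p := lt_trans one_pos hp.out
        refine Tendsto.rpow_const (tendsto_finsetSum _ fun i _ => ?_)
          (Or.inr (one_div_pos.2 hp0).le)
        refine Tendsto.rpow_const ?_ (Or.inr hp0.le)
        exact (((hy _).sub_const _).sub ((hy _).sub_const _)).abs
      refine le_of_tendsto ht ((eventually_ge_atTop N).mono fun j hj => ?_)
      refine (James.pVar_le_jnorm (u j - u m).mem hk n).trans ?_
      rw [← norm_eq, ← dist_eq_norm]
      exact (hN j hj m hm).le
  have hmem : James.Mem p y := by
    constructor
    · refine Metric.tendsto_atTop.2 fun ε hε => ?_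
      obtain ⟨N, hN⟩ := key (ε / 2) (half_pos hε)
      obtain ⟨M, hM⟩ := Metric.tendsto_atTop.1 (u N).mem.1 (ε / 2) (half_pos hε)
      refine ⟨M, fun a ha => ?_⟩
      have h1 := (hN N le_rfl).1 a
      have h2 := hM a ha
      rw [Real.dist_eq, sub_zero] at h2 ⊢
      have h3 := abs_sub_abs_le_abs_sub (y a) ((u N).toSeq a)
      rw [abs_sub_comm] at h3
      linarith
    · obtain ⟨N, hN⟩ := key 1 one_pos
      refine ⟨1 + ‖u N‖, ?_⟩
      rintro _ ⟨k, n, hk, rfl⟩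
      have h := James.pVar_add_le hp.out k n (y - (u N).toSeq) (u N).toSeq
      rw [sub_add_cancel] at h
      exact h.trans (add_le_add ((hN N le_rfl).2 k n hk) (James.pVar_le_jnorm (u N).mem hk n))
  let x : JamesSpace p := ⟨y, hmem⟩
  refine ⟨x, Metric.tendsto_atTop.2 fun ε hε => ?_⟩
  obtain ⟨N, hN⟩ := key (ε / 2) (half_pos hε)
  refine ⟨N, fun m hm => ?_⟩
  rw [dist_comm, dist_eq_norm, norm_eq]
  exact lt_of_le_of_lt (James.jnorm_le hp.out (hN m hm).2) (half_lt_self hε)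

end JamesSpace

/-! Equi-coarse embeddings of interlaced lists are obstructed by concentration. Write `s_n` for the
indicator of `[0, n)`. For interlaced `n₁ < m₁ < n₂ < m₂ < ⋯` the difference of the sums of the
`s_{n_i}` and of the `s_{m_i}` takes values in `{-1, 0}` and has total variation at most `2k`, so
its norm in `J_p` is at most `(2k)^(1/p)`. If instead one list lies wholly beyond the other, the
difference reaches absolute value `k`, while both sums have norm at most `k`; rate 1 expansion with
`L = 1/2` therefore applies to such pairs.

A coarse map is Lipschitz at large distances, so its images along interlaced lists are within `c ≈
(2k)^(1/p)`, up to a constant. In `J_q` a coordinatewise null perturbation adds its `q`-th power to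
the norm asymptotically (`eventually_jnorm_add_rpow_ge`). Hence the increments of the iterated
ultralimits of the images have `q`-th powers summing to about `c^q` at most
(`InterlacedLE.energyLE`), and two lists, one beyond the other, have images within `4kη +
2η^(1-q)c^q` for any `η > 0` (`InterlacedLE.exists_pair`). Since `c^q` is of order `k^(q/p) = o(k)`,
a small `η` contradicts the lower bound `k/C - C`.

Coordinatewise limits need not be null, so the argument in the target uses all sequences of bounded
`q`-variation, on which `jnorm` is only a seminorm. -/

namespace James

/-! ### Sequences of bounded variation, not necessarily null -/

variable {q : ℝ}

theorem pVar_rpow (hq : 1 < q) (k : ℕ → ℕ) (n : ℕ) (x : ℕ → ℝ) :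
    pVar q k n x ^ q = ∑ i ∈ Finset.range n, |x (k (i + 1)) - x (k i)| ^ q := by
  unfold pVar
  rw [← Real.rpow_mul (Finset.sum_nonneg fun _ _ => Real.rpow_nonneg (abs_nonneg _) _),
    one_div_mul_cancel (by linarith), Real.rpow_one]

theorem pVar_le_of_bddAbove {x : ℕ → ℝ} (hx : BddAbove (pVarSet q x)) {k : ℕ → ℕ}
    (hk : StrictMono k) (n : ℕ) : pVar q k n x ≤ jnorm q x :=
  le_csSup hx ⟨k, n, hk, rfl⟩

theorem bddAbove_pVarSet {x : ℕ → ℝ} {B : ℝ} (h : ∀ k n, StrictMono k → pVar q k n x ≤ B) :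
    BddAbove (pVarSet q x) :=
  ⟨B, by rintro _ ⟨k, n, hk, rfl⟩; exact h k n hk⟩

theorem bddAbove_pVarSet_add (hq : 1 < q) {x y : ℕ → ℝ} (hx : BddAbove (pVarSet q x))
    (hy : BddAbove (pVarSet q y)) : BddAbove (pVarSet q (x + y)) :=
  bddAbove_pVarSet fun k n hk => (pVar_add_le hq k n x y).trans
    (add_le_add (pVar_le_of_bddAbove hx hk n) (pVar_le_of_bddAbove hy hk n))

theorem jnorm_add_le (hq : 1 < q) {x y : ℕ → ℝ} (hx : BddAbove (pVarSet q x))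
    (hy : BddAbove (pVarSet q y)) : jnorm q (x + y) ≤ jnorm q x + jnorm q y :=
  jnorm_le hq fun k n hk => (pVar_add_le hq k n x y).trans
    (add_le_add (pVar_le_of_bddAbove hx hk n) (pVar_le_of_bddAbove hy hk n))

theorem pVar_neg (k : ℕ → ℕ) (n : ℕ) (x : ℕ → ℝ) : pVar q k n (-x) = pVar q k n x := by
  unfold pVar
  congr 1
  refine Finset.sum_congr rfl fun i _ => ?_
  congr 1
  rw [← abs_neg]
  congr 1
  simp only [Pi.neg_apply]
  ring

theorem pVarSet_neg (x : ℕ → ℝ) : pVarSet q (-x) = pVarSet q x := by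
  unfold pVarSet
  simp only [pVar_neg]

theorem jnorm_neg (x : ℕ → ℝ) : jnorm q (-x) = jnorm q x := by
  unfold jnorm
  rw [pVarSet_neg]

theorem bddAbove_pVarSet_sub (hq : 1 < q) {x y : ℕ → ℝ} (hx : BddAbove (pVarSet q x))
    (hy : BddAbove (pVarSet q y)) : BddAbove (pVarSet q (x - y)) := by
  rw [sub_eq_add_neg]
  exact bddAbove_pVarSet_add hq hx (by rwa [pVarSet_neg])

theorem jnorm_sub_le (hq : 1 < q) {x y : ℕ → ℝ} (hx : BddAbove (pVarSet q x))
    (hy : BddAbove (pVarSet q y)) : jnorm q (x - y) ≤ jnorm q x + jnorm q y := by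
  rw [sub_eq_add_neg, ← jnorm_neg y]
  exact jnorm_add_le hq hx (by rwa [pVarSet_neg])

/-- Repeated indices do not change the variation. -/
theorem exists_strictMono_sum_eq (hq : 1 < q) (x : ℕ → ℝ) {k : ℕ → ℕ} (hk : Monotone k) (n : ℕ) :
    ∃ (j : ℕ → ℕ) (m : ℕ), StrictMono j ∧ j m = k n ∧
      ∑ i ∈ Finset.range m, |x (j (i + 1)) - x (j i)| ^ q
        = ∑ i ∈ Finset.range n, |x (k (i + 1)) - x (k i)| ^ q := by
  induction n with
  | zero => exact ⟨fun i => k 0 + i, 0, fun a b h => Nat.add_lt_add_left h _, by simp, by simp⟩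
  | succ n ih =>
    obtain ⟨j, m, hj, hjm, hs⟩ := ih
    rcases (hk (Nat.le_succ n)).eq_or_lt with h | h
    · refine ⟨j, m, hj, hjm.trans h, ?_⟩
      have h0 : q ≠ 0 := by linarith
      rw [Finset.sum_range_succ, hs, ← Nat.succ_eq_add_one, ← h, sub_self, abs_zero,
        Real.zero_rpow h0, add_zero]
    -- The values after `m + 1` only keep the extension strictly increasing.
    · refine ⟨fun i => if i ≤ m then j i else k (n + 1) + (i - m - 1), m + 1, ?_, ?_, ?_⟩
      · refine strictMono_nat_of_lt_succ fun i => ?_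
        have h' : k n < k (n + 1) := h
        split_ifs with h1 h2 h2
        · exact hj (Nat.lt_succ_self i)
        · have : i = m := by omega
          subst this
          omega
        · omega
        · omega
      · simp
      · rw [Finset.sum_range_succ, Finset.sum_range_succ, ← hs]
        congr 1
        · refine Finset.sum_congr rfl fun i hi => ?_
          have hi' := Finset.mem_range.1 hi
          dsimp only
          rw [if_pos (by omega), if_pos (by omega)]
        · simp [hjm]

theorem sum_le_jnorm_rpow (hq : 1 < q) {x : ℕ → ℝ} (hx : BddAbove (pVarSet q x)) {k : ℕ → ℕ}
    (hk : Monotone k) (n : ℕ) :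
    ∑ i ∈ Finset.range n, |x (k (i + 1)) - x (k i)| ^ q ≤ jnorm q x ^ q := by
  obtain ⟨j, m, hj, -, hs⟩ := exists_strictMono_sum_eq hq x hk n
  rw [← hs, ← pVar_rpow hq]
  exact Real.rpow_le_rpow (pVar_nonneg _ _ _ _) (pVar_le_of_bddAbove hx hj m) (by linarith)

theorem jnorm_rpow_le (hq : 1 < q) {x : ℕ → ℝ} {c : ℝ}
    (h : ∀ k n, StrictMono k → ∑ i ∈ Finset.range n, |x (k (i + 1)) - x (k i)| ^ q ≤ c) :
    BddAbove (pVarSet q x) ∧ jnorm q x ^ q ≤ c := by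
  have hc : 0 ≤ c := by simpa using h id 0 strictMono_id
  have hq0 : 0 < q := by linarith
  have key : ∀ k n, StrictMono k → pVar q k n x ≤ c ^ (1 / q) := fun k n hk =>
    Real.rpow_le_rpow (Finset.sum_nonneg fun _ _ => Real.rpow_nonneg (abs_nonneg _) _)
      (h k n hk) (one_div_pos.2 hq0).le
  refine ⟨bddAbove_pVarSet key, ?_⟩
  calc jnorm q x ^ q ≤ (c ^ (1 / q)) ^ q :=
        Real.rpow_le_rpow (jnorm_nonneg _) (jnorm_le hq key) hq0.le
    _ = c := by rw [← Real.rpow_mul hc, one_div_mul_cancel hq0.ne', Real.rpow_one]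

theorem exists_lt_sum (hq : 1 < q) (x : ℕ → ℝ) {ε : ℝ} (hε : 0 < ε) :
    ∃ (k : ℕ → ℕ) (n : ℕ), StrictMono k ∧
      jnorm q x ^ q - ε < ∑ i ∈ Finset.range n, |x (k (i + 1)) - x (k i)| ^ q := by
  by_contra! h
  linarith [(jnorm_rpow_le hq h).2]

theorem tendsto_sum_rpow (hq : 1 < q) {ι : Type*} {F : Filter ι} {u : ι → ℕ → ℝ} {x : ℕ → ℝ}
    (h : ∀ t, Tendsto (fun i => u i t) F (𝓝 (x t))) (k : ℕ → ℕ) (n : ℕ) :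
    Tendsto (fun a => ∑ i ∈ Finset.range n, |u a (k (i + 1)) - u a (k i)| ^ q) F
      (𝓝 (∑ i ∈ Finset.range n, |x (k (i + 1)) - x (k i)| ^ q)) :=
  tendsto_finsetSum _ fun i _ => (((h _).sub (h _)).abs).rpow_const (Or.inr (by linarith))

/-- Lower semicontinuity of the variation under coordinatewise convergence. -/
theorem eventually_jnorm_rpow_gt (hq : 1 < q) {ι : Type*} {F : Filter ι} {u : ι → ℕ → ℝ}
    {x : ℕ → ℝ} (h : ∀ t, Tendsto (fun i => u i t) F (𝓝 (x t)))
    (hu : ∀ i, BddAbove (pVarSet q (u i))) {ε : ℝ} (hε : 0 < ε) :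
    ∀ᶠ i in F, jnorm q x ^ q - ε < jnorm q (u i) ^ q := by
  obtain ⟨k, n, hk, hlt⟩ := exists_lt_sum hq x hε
  filter_upwards [(tendsto_sum_rpow hq h k n).eventually (lt_mem_nhds hlt)] with i hi
  exact hi.trans_le (sum_le_jnorm_rpow hq (hu i) hk.monotone n)

/-! ### Tails and the asymptotic lower `q`-estimate -/

/-- The sequence seen from the index `T` on. -/
def tail (T : ℕ) (x : ℕ → ℝ) : ℕ → ℝ := fun t => x (T + t)

/-- Superadditivity of the `q`-th power of the variation over consecutive intervals. -/
theorem sum_add_jnorm_tail_le (hq : 1 < q) {x : ℕ → ℝ} (hx : BddAbove (pVarSet q x)) {k : ℕ → ℕ}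
    (hk : StrictMono k) (n : ℕ) :
    BddAbove (pVarSet q (tail (k n) x)) ∧
    ∑ i ∈ Finset.range n, |x (k (i + 1)) - x (k i)| ^ q + jnorm q (tail (k n) x) ^ q
      ≤ jnorm q x ^ q := by
  have key : ∀ j m, StrictMono j →
      ∑ i ∈ Finset.range m, |tail (k n) x (j (i + 1)) - tail (k n) x (j i)| ^ q ≤
        jnorm q x ^ q - ∑ i ∈ Finset.range n, |x (k (i + 1)) - x (k i)| ^ q := by
    intro j m hj
    -- Follow `k` up to `k n`, then `j` shifted by `k n`. As `j 0` may be `0`, this is only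
    -- monotone. The junction term, at index `n`, is discarded below.
    let r : ℕ → ℕ := fun i => if i ≤ n then k i else k n + j (i - n - 1)
    have hr : Monotone r := by
      refine monotone_nat_of_le_succ fun i => ?_
      simp only [r]
      split_ifs with h1 h2 h2
      · exact hk.monotone (Nat.le_succ i)
      · have : i = n := by omega
        subst this
        omega
      · omega
      · exact Nat.add_le_add_left (hj.monotone (by omega)) _
    have h := sum_le_jnorm_rpow hq hx hr (n + 1 + m)
    rw [Finset.sum_range_add, Finset.sum_range_succ] at h
    have h1 : ∑ i ∈ Finset.range n, |x (r (i + 1)) - x (r i)| ^ q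
        = ∑ i ∈ Finset.range n, |x (k (i + 1)) - x (k i)| ^ q :=
      Finset.sum_congr rfl fun i hi => by
        have hi' := Finset.mem_range.1 hi
        simp only [r]
        rw [if_pos (by omega), if_pos (by omega)]
    have h2 : ∑ i ∈ Finset.range m, |x (r (n + 1 + i + 1)) - x (r (n + 1 + i))| ^ q
        = ∑ i ∈ Finset.range m, |tail (k n) x (j (i + 1)) - tail (k n) x (j i)| ^ q :=
      Finset.sum_congr rfl fun i hi => by
        simp only [r, tail]
        rw [if_neg (by omega), if_neg (by omega)]
        congr 6 <;> omega
    rw [h1, h2] at h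
    have h3 : 0 ≤ |x (r (n + 1)) - x (r n)| ^ q := Real.rpow_nonneg (abs_nonneg _) _
    linarith
  obtain ⟨h1, h2⟩ := jnorm_rpow_le hq key
  exact ⟨h1, by linarith⟩

theorem sum_rpow_le_rpow_sum (hq : 1 < q) {ι : Type*} (s : Finset ι) {a : ι → ℝ}
    (ha : ∀ i, 0 ≤ a i) : ∑ i ∈ s, a i ^ q ≤ (∑ i ∈ s, a i) ^ q := by
  classical
  induction s using Finset.induction_on with
  | empty => simp [Real.zero_rpow (by linarith : q ≠ 0)]
  | insert i s hi ih =>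
    rw [Finset.sum_insert hi, Finset.sum_insert hi]
    exact (add_le_add_right ih _).trans
      (Real.add_rpow_le_rpow_add (ha i) (Finset.sum_nonneg fun _ _ => ha _) hq.le)

/-- The variation is bounded by that of the tail plus the size of the finitely many values before
it. -/
theorem jnorm_le_jnorm_tail (hq : 1 < q) (x : ℕ → ℝ) (T : ℕ)
    (hT : BddAbove (pVarSet q (tail T x))) :
    jnorm q x ≤ jnorm q (tail T x) + 2 * ∑ t ∈ Finset.range T, |x t - x T| := by
  have hq0 : 0 < q := by linarith
  -- `y` is frozen at `x T` before `T`, so its variation is that of the tail; `z` is the finitely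
  -- supported remainder.
  set y : ℕ → ℝ := fun t => x (T + (t - T)) with hy
  set z : ℕ → ℝ := fun t => if t < T then x t - x T else 0 with hz
  have hxyz : x = y + z := by
    funext t
    simp only [hy, hz, Pi.add_apply]
    split_ifs with h
    · rw [Nat.sub_eq_zero_of_le h.le]; simp
    · rw [Nat.add_sub_cancel' (by omega)]; simp
  have h1 : BddAbove (pVarSet q y) ∧ jnorm q y ^ q ≤ jnorm q (tail T x) ^ q :=
    jnorm_rpow_le hq fun k n hk =>
      sum_le_jnorm_rpow hq hT (k := fun i => k i - T)
        (fun a b hab => Nat.sub_le_sub_right (hk.monotone hab) T) n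
  have h2 : BddAbove (pVarSet q z) ∧
      jnorm q z ^ q ≤ (2 * ∑ t ∈ Finset.range T, |x t - x T|) ^ q := by
    refine jnorm_rpow_le hq fun k n hk => ?_
    refine (sum_rpow_le_rpow_sum hq _ fun _ => abs_nonneg _).trans ?_
    refine Real.rpow_le_rpow (Finset.sum_nonneg fun _ _ => abs_nonneg _) ?_ hq0.le
    have h3 : ∀ r : ℕ → ℕ, Function.Injective r →
        ∑ i ∈ Finset.range n, |z (r i)| ≤ ∑ t ∈ Finset.range T, |x t - x T| := by
      intro r hr
      have e : ∑ t ∈ Finset.range T, |x t - x T| = ∑ t ∈ Finset.range T, |z t| :=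
        Finset.sum_congr rfl fun t ht => by simp only [hz, if_pos (Finset.mem_range.1 ht)]
      rw [e, ← Finset.sum_image (s := Finset.range n) (g := r) (f := fun t => |z t|)
        (fun a _ b _ hab => hr hab)]
      rw [Finset.sum_subset (s₁ := Finset.range T)
        (Finset.subset_union_right (s₁ := (Finset.range n).image r))
        fun t _ ht => by
          have ht' : ¬ t < T := by simpa using ht
          simp only [hz, if_neg ht', abs_zero]]
      exact Finset.sum_le_sum_of_subset_of_nonneg Finset.subset_union_left
        fun _ _ _ => abs_nonneg _
    calc ∑ i ∈ Finset.range n, |z (k (i + 1)) - z (k i)|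
        ≤ ∑ i ∈ Finset.range n, (|z (k (i + 1))| + |z (k i)|) :=
          Finset.sum_le_sum fun _ _ => abs_sub _ _
      _ ≤ _ := by
          rw [Finset.sum_add_distrib, two_mul]
          exact add_le_add (h3 (fun i => k (i + 1)) (hk.injective.comp (add_left_injective 1)))
            (h3 k hk.injective)
  have hs : 0 ≤ 2 * ∑ t ∈ Finset.range T, |x t - x T| :=
    mul_nonneg two_pos.le (Finset.sum_nonneg fun _ _ => abs_nonneg _)
  have h4 := (Real.rpow_le_rpow_iff (jnorm_nonneg _) (jnorm_nonneg _) hq0).1 h1.2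
  have h5 := (Real.rpow_le_rpow_iff (jnorm_nonneg _) hs hq0).1 h2.2
  calc jnorm q x = jnorm q (y + z) := by rw [← hxyz]
    _ ≤ jnorm q y + jnorm q z := jnorm_add_le hq h1.1 h2.1
    _ ≤ _ := add_le_add h4 h5

/-- Uniform continuity of `a ↦ a ^ q` on bounded sets, in one-sided form. -/
theorem exists_rpow_sub_lt (hq : 1 < q) (B : ℝ) {ε : ℝ} (hε : 0 < ε) :
    ∃ δ > 0, ∀ a b : ℝ, 0 ≤ a → a ≤ B → 0 ≤ b → a - δ ≤ b → a ^ q - ε ≤ b ^ q := by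
  have hu : UniformContinuousOn (fun a : ℝ => a ^ q) (Set.Icc 0 B) :=
    isCompact_Icc.uniformContinuousOn_of_continuous
      (Real.continuous_rpow_const (by linarith)).continuousOn
  obtain ⟨δ, hδ, h⟩ := Metric.uniformContinuousOn_iff.1 hu ε hε
  refine ⟨δ / 2, half_pos hδ, fun a b ha haB hb hab => ?_⟩
  rcases le_total a b with h1 | h1
  · linarith [Real.rpow_le_rpow ha h1 (by linarith : 0 ≤ q)]
  · have := h a ⟨ha, haB⟩ b ⟨hb, h1.trans haB⟩ (by rw [Real.dist_eq, abs_of_nonneg] <;> linarith)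
    rw [Real.dist_eq] at this
    linarith [(abs_lt.1 this).2]

/-- Asymptotic lower `q`-estimate for coordinatewise null perturbations. -/
theorem eventually_jnorm_add_rpow_ge (hq : 1 < q) {ι : Type*} {F : Filter ι} {w : ℕ → ℝ}
    (hw : BddAbove (pVarSet q w)) {z : ι → ℕ → ℝ} {B : ℝ}
    (hz : ∀ i, BddAbove (pVarSet q (z i))) (hB : ∀ i, jnorm q (z i) ≤ B)
    (h0 : ∀ t, Tendsto (fun i => z i t) F (𝓝 0)) {ε : ℝ} (hε : 0 < ε) :
    ∀ᶠ i in F, jnorm q w ^ q + jnorm q (z i) ^ q - ε ≤ jnorm q (w + z i) ^ q := by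
  have hq0 : 0 < q := by linarith
  obtain ⟨δ, hδ, hpow⟩ := exists_rpow_sub_lt hq B (half_pos hε)
  -- The first bound keeps almost all the energy of `w` before `k n`; the second makes the tail of
  -- `w` at most `δ / 2`. The other `δ / 2` pays for the values of `z i` up to `k n`.
  have hη : 0 < min (ε / 4) ((δ / 2) ^ q) := lt_min (by linarith) (Real.rpow_pos_of_pos (by linarith) _)
  obtain ⟨k, n, hk, hlt⟩ := exists_lt_sum hq w hη
  obtain ⟨hwT, hwk⟩ := sum_add_jnorm_tail_le hq hw hk n
  have hwT2 : jnorm q (tail (k n) w) ≤ δ / 2 := by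
    refine (Real.rpow_le_rpow_iff (jnorm_nonneg _) (by linarith) hq0).1 ?_
    linarith [min_le_right (ε / 4) ((δ / 2) ^ q)]
  have ht1 : ∀ᶠ i in F, jnorm q w ^ q - ε / 2 <
      ∑ a ∈ Finset.range n, |(w + z i) (k (a + 1)) - (w + z i) (k a)| ^ q := by
    have h1 : ∀ t, Tendsto (fun i => (w + z i) t) F (𝓝 (w t)) := fun t => by
      simpa using (h0 t).const_add (w t)
    refine (tendsto_sum_rpow hq h1 k n).eventually (lt_mem_nhds ?_)
    linarith [min_le_left (ε / 4) ((δ / 2) ^ q)]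
  have ht2 : ∀ᶠ i in F, 2 * ∑ t ∈ Finset.range (k n), |z i t - z i (k n)| < δ / 2 := by
    have h2 : Tendsto (fun i => 2 * ∑ t ∈ Finset.range (k n), |z i t - z i (k n)|) F
        (𝓝 (2 * ∑ t ∈ Finset.range (k n), |(0 : ℝ) - 0|)) :=
      (tendsto_finsetSum _ fun t _ => ((h0 t).sub (h0 _)).abs).const_mul 2
    simp only [sub_zero, abs_zero, Finset.sum_const_zero, mul_zero] at h2
    exact h2.eventually (gt_mem_nhds (by linarith))
  filter_upwards [ht1, ht2] with i h1 h2
  have hsum := sum_add_jnorm_tail_le hq (bddAbove_pVarSet_add hq hw (hz i)) hk n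
  have hzT := (sum_add_jnorm_tail_le hq (hz i) hk n).1
  have h3 : jnorm q (tail (k n) (z i)) ≤
      jnorm q (tail (k n) (w + z i)) + jnorm q (tail (k n) w) := by
    have e : tail (k n) (z i) = tail (k n) (w + z i) - tail (k n) w := by
      funext t; simp [tail]
    rw [e]
    exact jnorm_sub_le hq hsum.1 hwT
  have h4 := jnorm_le_jnorm_tail hq (z i) (k n) hzT
  have h5 := hpow (jnorm q (z i)) (jnorm q (tail (k n) (w + z i))) (jnorm_nonneg _) (hB i)
    (jnorm_nonneg _) (by linarith)
  linarith [hsum.2]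

end James

/-! ### Iterated ultralimits and concentration along interlaced lists -/

namespace James

variable {q : ℝ}

/-- A common bound for the values and the variation of a sequence. -/
def VarBoundedBy (q B : ℝ) (x : ℕ → ℝ) : Prop :=
  (∀ t, |x t| ≤ B) ∧ ∀ k n, StrictMono k → pVar q k n x ≤ B

theorem VarBoundedBy.bddAbove {B : ℝ} {x : ℕ → ℝ} (h : VarBoundedBy q B x) :
    BddAbove (pVarSet q x) :=
  bddAbove_pVarSet h.2

theorem VarBoundedBy.of_tendsto (hq : 1 < q) {ι : Type*} {F : Filter ι} [F.NeBot] {B : ℝ}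
    {u : ι → ℕ → ℝ} {x : ℕ → ℝ} (hu : ∀ i, VarBoundedBy q B (u i))
    (h : ∀ t, Tendsto (fun i => u i t) F (𝓝 (x t))) : VarBoundedBy q B x := by
  refine ⟨fun t => le_of_tendsto (h t).abs (Eventually.of_forall fun i => (hu i).1 t),
    fun k n hk => ?_⟩
  refine le_of_tendsto ((tendsto_sum_rpow hq h k n).rpow_const (Or.inr ?_))
    (Eventually.of_forall fun i => (hu i).2 k n hk)
  exact (one_div_pos.2 (by linarith)).le

/-- The iterated coordinatewise ultralimit of a family of sequences indexed by lists of
length `k`. -/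
noncomputable def iterLim : ℕ → (List ℕ → ℕ → ℝ) → ℕ → ℝ
  | 0, φ => φ []
  | k + 1, φ => fun t => limUnder (hyperfilter ℕ : Filter ℕ)
      fun n => iterLim k (fun l => φ (n :: l)) t

theorem tendsto_iterLim_of_varBoundedBy {B : ℝ} {k : ℕ} {φ : List ℕ → ℕ → ℝ}
    (h : ∀ n, VarBoundedBy q B (iterLim k fun l => φ (n :: l))) (t : ℕ) :
    Tendsto (fun n => iterLim k (fun l => φ (n :: l)) t) (hyperfilter ℕ : Filter ℕ)
      (𝓝 (iterLim (k + 1) φ t)) := by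
  obtain ⟨a, -, ha⟩ := (isCompact_Icc (a := -B) (b := B)).ultrafilter_le_nhds
    ((hyperfilter ℕ).map fun n => iterLim k (fun l => φ (n :: l)) t)
    (by
      rw [le_principal_iff]
      exact mem_map.2 (univ_mem' fun n => abs_le.1 ((h n).1 t)))
  exact tendsto_nhds_limUnder ⟨a, ha⟩

theorem varBoundedBy_iterLim (hq : 1 < q) {B : ℝ} {k : ℕ} : ∀ {φ : List ℕ → ℕ → ℝ},
    (∀ l, l.length = k → VarBoundedBy q B (φ l)) → VarBoundedBy q B (iterLim k φ) := by
  induction k with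
  | zero => exact fun h => h [] rfl
  | succ k ih =>
    intro φ h
    have h1 : ∀ n, VarBoundedBy q B (iterLim k fun l => φ (n :: l)) := fun n =>
      ih fun l hl => h (n :: l) (by simp [hl])
    exact VarBoundedBy.of_tendsto hq h1 (tendsto_iterLim_of_varBoundedBy h1)

theorem tendsto_iterLim (hq : 1 < q) {B : ℝ} {k : ℕ} {φ : List ℕ → ℕ → ℝ}
    (h : ∀ l, l.length = k + 1 → VarBoundedBy q B (φ l)) (t : ℕ) :
    Tendsto (fun n => iterLim k (fun l => φ (n :: l)) t) (hyperfilter ℕ : Filter ℕ)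
      (𝓝 (iterLim (k + 1) φ t)) :=
  tendsto_iterLim_of_varBoundedBy
    (fun n => varBoundedBy_iterLim hq fun l hl => h (n :: l) (by simp [hl])) t

/-- Generically, the `q`-th powers of the variations of the successive differences of iterated
limits add up to at most `s`, up to an error `ε` at each step. -/
def EnergyLE (q ε : ℝ) : ℕ → (List ℕ → ℕ → ℝ) → ℝ → Prop
  | 0, _, s => 0 ≤ s
  | k + 1, φ, s => ∀ᶠ n in (hyperfilter ℕ : Filter ℕ), EnergyLE q ε k (fun l => φ (n :: l))
      (s + ε - jnorm q (iterLim k (fun l => φ (n :: l)) - iterLim (k + 1) φ) ^ q)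

theorem EnergyLE.mono {ε : ℝ} {k : ℕ} : ∀ {φ : List ℕ → ℕ → ℝ} {s s' : ℝ},
    EnergyLE q ε k φ s → s ≤ s' → EnergyLE q ε k φ s' := by
  induction k with
  | zero => exact fun h hs => le_trans h hs
  | succ k ih =>
    intro φ s s' h hs
    exact Eventually.mono h fun n hn => ih hn (by linarith)

/-- Two families of sequences are generically at distance at most `c` along interlaced lists. -/
def InterlacedLE (q c : ℝ) : ℕ → (List ℕ → ℕ → ℝ) → (List ℕ → ℕ → ℝ) → Prop
  | 0, φ, ψ => jnorm q (φ [] - ψ []) ≤ c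
  | k + 1, φ, ψ => ∀ᶠ n in (hyperfilter ℕ : Filter ℕ), ∀ᶠ m in (hyperfilter ℕ : Filter ℕ),
      InterlacedLE q c k (fun l => φ (n :: l)) (fun l => ψ (m :: l))

/-- A second family `ψ` makes the induction work. Moving the first entry of `φ` to `n` increases the
`q`-th power of the distance between the limits by that of the increment (lower `q`-estimate).
Moving the first entry of `ψ` to a suitable `m` loses almost nothing (lower semicontinuity). The
final distance is at most `c`, which caps the total. -/
theorem InterlacedLE.energyLE (hq : 1 < q) {ε c B : ℝ} (hε : 0 < ε) (k : ℕ) :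
    ∀ φ ψ : List ℕ → ℕ → ℝ, (∀ l, l.length = k → VarBoundedBy q B (φ l)) →
      (∀ l, l.length = k → VarBoundedBy q B (ψ l)) → InterlacedLE q c k φ ψ →
      EnergyLE q ε k φ (c ^ q - jnorm q (iterLim k φ - iterLim k ψ) ^ q) := by
  induction k with
  | zero =>
    intro φ ψ _ _ h
    exact sub_nonneg.2 (Real.rpow_le_rpow (jnorm_nonneg _) h (by linarith))
  | succ k ih =>
    intro φ ψ hφ hψ h
    have hφ1 : ∀ n l, l.length = k → VarBoundedBy q B (φ (n :: l)) := fun n l hl =>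
      hφ (n :: l) (by simp [hl])
    have hψ1 : ∀ n l, l.length = k → VarBoundedBy q B (ψ (n :: l)) := fun n l hl =>
      hψ (n :: l) (by simp [hl])
    have bφ := (varBoundedBy_iterLim hq hφ).bddAbove
    have bψ := (varBoundedBy_iterLim hq hψ).bddAbove
    have bφ1 := fun n => (varBoundedBy_iterLim hq (hφ1 n))
    have bψ1 := fun n => (varBoundedBy_iterLim hq (hψ1 n)).bddAbove
    have hz := eventually_jnorm_add_rpow_ge (F := (hyperfilter ℕ : Filter ℕ)) hq
      (w := iterLim (k + 1) φ - iterLim (k + 1) ψ)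
      (z := fun n => iterLim k (fun l => φ (n :: l)) - iterLim (k + 1) φ)
      (B := B + B) (bddAbove_pVarSet_sub hq bφ bψ)
      (fun n => bddAbove_pVarSet_sub hq (bφ1 n).bddAbove bφ)
      (fun n => (jnorm_sub_le hq (bφ1 n).bddAbove bφ).trans
        (add_le_add (jnorm_le hq (bφ1 n).2) (jnorm_le hq (varBoundedBy_iterLim hq hφ).2)))
      (fun t => by simpa using (tendsto_iterLim hq hφ t).sub_const (iterLim (k + 1) φ t))
      (half_pos hε)
    filter_upwards [h, hz] with n hn hzn
    have hlsc := eventually_jnorm_rpow_gt (F := (hyperfilter ℕ : Filter ℕ)) hq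
      (u := fun m => iterLim k (fun l => φ (n :: l)) - iterLim k (fun l => ψ (m :: l)))
      (x := iterLim k (fun l => φ (n :: l)) - iterLim (k + 1) ψ)
      (fun t => (tendsto_iterLim hq hψ t).const_sub _)
      (fun m => bddAbove_pVarSet_sub hq (bφ1 n).bddAbove (bψ1 m)) (half_pos hε)
    -- A single good `m` suffices, because the conclusion concerns `φ` alone.
    obtain ⟨m, hm, hm2⟩ := (hn.and hlsc).exists
    refine (ih _ _ (hφ1 n) (hψ1 m) hm).mono ?_
    have e : iterLim (k + 1) φ - iterLim (k + 1) ψ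
        + (iterLim k (fun l => φ (n :: l)) - iterLim (k + 1) φ)
        = iterLim k (fun l => φ (n :: l)) - iterLim (k + 1) ψ := by abel
    rw [e] at hzn
    linarith

/-- Plays the role of Hölder's inequality: a bound on a sum of `q`-th powers becomes a bound on the
sum, one term at a time. -/
theorem le_add_rpow_mul (hq : 1 < q) {a η : ℝ} (ha : 0 ≤ a) (hη : 0 < η) :
    a ≤ η + η ^ (1 - q) * a ^ q := by
  rcases le_total a η with h | h
  · have : 0 ≤ η ^ (1 - q) * a ^ q :=
      mul_nonneg (Real.rpow_nonneg hη.le _) (Real.rpow_nonneg ha _)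
    linarith
  · have ha' : 0 < a := hη.trans_le h
    have h1 : a ^ (1 - q) ≤ η ^ (1 - q) :=
      Real.rpow_le_rpow_of_nonpos hη h (by linarith)
    calc a = a ^ (1 - q) * a ^ q := by
          rw [← Real.rpow_add ha', sub_add_cancel, Real.rpow_one]
      _ ≤ η ^ (1 - q) * a ^ q := mul_le_mul_of_nonneg_right h1 (Real.rpow_nonneg ha _)
      _ ≤ _ := by linarith

/-- Entries are chosen one by one along the nested ultrafilters, and the triangle inequality sums
the increments. The free `N` allows a list beyond any given one. -/
theorem EnergyLE.exists_list (hq : 1 < q) {ε B η : ℝ} (hη : 0 < η) (N k : ℕ) :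
    ∀ (φ : List ℕ → ℕ → ℝ) (s : ℝ), (∀ l, l.length = k → VarBoundedBy q B (φ l)) →
      EnergyLE q ε k φ s → ∃ l : List ℕ, l.length = k ∧ (∀ i ∈ l, N < i) ∧
        jnorm q (φ l - iterLim k φ) ≤ k * η + η ^ (1 - q) * (s + k * ε) := by
  have hη' : 0 ≤ η ^ (1 - q) := Real.rpow_nonneg hη.le _
  induction k with
  | zero =>
    intro φ s _ h
    refine ⟨[], rfl, by simp, ?_⟩
    have h0 : jnorm q (0 : ℕ → ℝ) ≤ 0 := jnorm_le hq fun k n _ => by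
      have := pVar_smul hq k n 0 (0 : ℕ → ℝ)
      rw [zero_smul, abs_zero, zero_mul] at this
      exact this.le
    simp only [iterLim, sub_self, Nat.cast_zero, zero_mul, add_zero, zero_add]
    exact h0.trans (mul_nonneg hη' h)
  | succ k ih =>
    intro φ s hφ h
    have hφ1 : ∀ n l, l.length = k → VarBoundedBy q B (φ (n :: l)) := fun n l hl =>
      hφ (n :: l) (by simp [hl])
    obtain ⟨n, hn, hNn⟩ := (Eventually.and h
      (Nat.hyperfilter_le_atTop (eventually_gt_atTop N))).exists
    obtain ⟨l, hl, hlN, hle⟩ := ih _ _ (hφ1 n) hn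
    refine ⟨n :: l, by simp [hl], by simpa using ⟨hNn, hlN⟩, ?_⟩
    have b1 := (varBoundedBy_iterLim hq (hφ1 n)).bddAbove
    have b2 := (varBoundedBy_iterLim hq hφ).bddAbove
    have e : φ (n :: l) - iterLim (k + 1) φ = (φ (n :: l) - iterLim k fun l => φ (n :: l))
        + ((iterLim k fun l => φ (n :: l)) - iterLim (k + 1) φ) := by abel
    have h1 := jnorm_add_le hq (bddAbove_pVarSet_sub hq (hφ1 n l hl).bddAbove b1)
      (bddAbove_pVarSet_sub hq b1 b2)
    have h2 := le_add_rpow_mul hq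
      (jnorm_nonneg (p := q) ((iterLim k fun l => φ (n :: l)) - iterLim (k + 1) φ)) hη
    rw [e]
    push_cast
    refine h1.trans ((add_le_add hle h2).trans (le_of_eq ?_))
    ring

/-- Concentration of families with small variation along interlaced lists. -/
theorem InterlacedLE.exists_pair (hq : 1 < q) {c B η : ℝ} (hη : 0 < η) {k : ℕ}
    {φ : List ℕ → ℕ → ℝ} (hφ : ∀ l, l.length = k → VarBoundedBy q B (φ l))
    (h : InterlacedLE q c k φ φ) :
    ∃ (l l' : List ℕ) (N : ℕ), l.length = k ∧ l'.length = k ∧ (∀ i ∈ l, i ≤ N) ∧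
      (∀ i ∈ l', N < i) ∧ jnorm q (φ l - φ l') ≤ 4 * (k * η) + 2 * (η ^ (1 - q) * c ^ q) := by
  -- The error `η ^ q` per step costs `η ^ (1 - q) * (k * η ^ q) = k * η` in total.
  have hE := (InterlacedLE.energyLE hq (Real.rpow_pos_of_pos hη q) k φ φ hφ hφ h).mono
    (sub_le_self _ (Real.rpow_nonneg (jnorm_nonneg _) _))
  obtain ⟨l, hl, -, h1⟩ := EnergyLE.exists_list hq hη 0 k φ _ hφ hE
  -- `l.sum` bounds every entry of `l`.
  obtain ⟨l', hl', hN, h2⟩ := EnergyLE.exists_list hq hη l.sum k φ _ hφ hE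
  refine ⟨l, l', l.sum, hl, hl', fun i hi => List.le_sum_of_mem hi, hN, ?_⟩
  have b := (varBoundedBy_iterLim hq hφ).bddAbove
  have h3 := jnorm_sub_le hq (bddAbove_pVarSet_sub hq (hφ l hl).bddAbove b)
    (bddAbove_pVarSet_sub hq (hφ l' hl').bddAbove b)
  rw [sub_sub_sub_cancel_right] at h3
  have e : η ^ (1 - q) * (k * η ^ q) = k * η := by
    rw [mul_left_comm, ← Real.rpow_add hη, sub_add_cancel, Real.rpow_one]
  rw [mul_add, e] at h1 h2
  linarith

end James

/-! ### Coarse maps are Lipschitz at large distances -/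

/-- The segment from `z` to `x` is cut into `⌈‖x - z‖⌉₊` steps of length at most 1. -/
theorem IsCoarseMap.exists_norm_sub_le {X Y : Type*} [NormedAddCommGroup X] [NormedSpace ℝ X]
    [NormedAddCommGroup Y] {f : X → Y} (hf : IsCoarseMap f) :
    ∃ K : ℝ, 0 ≤ K ∧ ∀ x z, ‖f x - f z‖ ≤ K * (‖x - z‖ + 1) := by
  obtain ⟨K, hK⟩ := hf 1 zero_le_one
  have hK1 : ∀ x z, dist x z ≤ 1 → dist (f x) (f z) ≤ K := fun x z h => hK ⟨x, z, h, rfl⟩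
  have hK0 : 0 ≤ K := dist_nonneg.trans (hK1 0 0 (by simp))
  refine ⟨K, hK0, fun x z => ?_⟩
  rcases eq_or_ne x z with rfl | hxz
  · simpa using hK0
  set M := ⌈‖x - z‖⌉₊ with hM
  have hd : 0 < ‖x - z‖ := norm_pos_iff.2 (sub_ne_zero.2 hxz)
  have hM0 : (0 : ℝ) < M := Nat.cast_pos.2 (Nat.ceil_pos.2 hd)
  have hchain := dist_le_range_sum_dist (fun i : ℕ => f (z + ((i : ℝ) / M) • (x - z))) M
  have hstep : ∀ i : ℕ, dist (f (z + ((i : ℝ) / M) • (x - z)))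
      (f (z + (((i + 1 : ℕ) : ℝ) / M) • (x - z))) ≤ K := fun i => by
    refine hK1 _ _ ?_
    rw [dist_add_left, dist_eq_norm, ← sub_smul, norm_smul, Real.norm_eq_abs]
    have : (i : ℝ) / M - ((i + 1 : ℕ) : ℝ) / M = -(1 / M) := by push_cast; ring
    rw [this, abs_neg, abs_of_pos (one_div_pos.2 hM0), one_div_mul_eq_div, div_le_one hM0]
    exact Nat.le_ceil _
  have hsum := hchain.trans (Finset.sum_le_sum fun i _ => hstep i)
  simp only [Nat.cast_zero, zero_div, zero_smul, add_zero, div_self hM0.ne', one_smul,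
    add_sub_cancel, Finset.sum_const, Finset.card_range, nsmul_eq_mul] at hsum
  rw [dist_comm, dist_eq_norm] at hsum
  refine hsum.trans ?_
  rw [mul_comm]
  exact mul_le_mul_of_nonneg_left (Nat.ceil_lt_add_one hd.le).le hK0

/-! ### Sums of initial indicators in `J_p` -/

namespace James

/-- Jumps `d` of size at most 1 satisfy `|d| ^ p ≤ |d|`, so total variation controls the norm. -/
theorem jnorm_rpow_le_of_sum_le {p : ℝ} (hp : 1 < p) {u : ℕ → ℝ} {M : ℝ}
    (h1 : ∀ s t, |u s - u t| ≤ 1)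
    (hM : ∀ k n, StrictMono k → ∑ i ∈ Finset.range n, |u (k (i + 1)) - u (k i)| ≤ M) :
    BddAbove (pVarSet p u) ∧ jnorm p u ^ p ≤ M := by
  refine jnorm_rpow_le hp fun k n hk => (Finset.sum_le_sum fun i _ => ?_).trans (hM k n hk)
  simpa using Real.rpow_le_rpow_of_exponent_ge' (abs_nonneg _) (h1 (k (i + 1)) (k i))
    zero_le_one hp.le

/-- The indicator function of `[0, n)`. -/
def initSeq (n : ℕ) : ℕ → ℝ := fun t => if t < n then 1 else 0

theorem sum_abs_initSeq_le (n : ℕ) {k : ℕ → ℕ} (hk : StrictMono k) (m : ℕ) :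
    ∑ i ∈ Finset.range m, |initSeq n (k (i + 1)) - initSeq n (k i)| ≤ 1 := by
  have h : ∀ i, |initSeq n (k (i + 1)) - initSeq n (k i)|
      = initSeq n (k i) - initSeq n (k (i + 1)) := fun i => by
    have : k i < k (i + 1) := hk (Nat.lt_succ_self i)
    rw [abs_sub_comm, abs_of_nonneg]
    simp only [initSeq]
    split_ifs <;> first | omega | norm_num
  simp only [h]
  rw [Finset.sum_range_sub' (fun i => initSeq n (k i))]
  simp only [initSeq]
  split_ifs <;> norm_num

theorem abs_initSeq_sub_le (n s t : ℕ) : |initSeq n s - initSeq n t| ≤ 1 := by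
  simp only [initSeq]
  split_ifs <;> norm_num

theorem mem_initSeq {p : ℝ} (hp : 1 < p) (n : ℕ) : Mem p (initSeq n) := by
  refine ⟨tendsto_const_nhds.congr' ?_,
    (jnorm_rpow_le_of_sum_le hp (abs_initSeq_sub_le n) fun k m hk => sum_abs_initSeq_le n hk m).1⟩
  filter_upwards [eventually_ge_atTop n] with t ht
  simp [initSeq, ht]

end James

namespace JamesSpace

variable {p : ℝ} [hp : Fact (1 < p)]

/-- The indicator function of `[0, n)` as an element of the James space. -/
def initVec (p : ℝ) [hp : Fact (1 < p)] (n : ℕ) : JamesSpace p :=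
  ⟨James.initSeq n, James.mem_initSeq hp.out n⟩

theorem toSeq_initVec (n : ℕ) : (initVec p n).toSeq = James.initSeq n := rfl

theorem norm_initVec_le (n : ℕ) : ‖initVec p n‖ ≤ 1 := by
  have hp0 : 0 < p := lt_trans one_pos hp.out
  refine (Real.rpow_le_rpow_iff (norm_nonneg _) zero_le_one hp0).1 ?_
  rw [Real.one_rpow]
  exact (James.jnorm_rpow_le_of_sum_le hp.out (James.abs_initSeq_sub_le n)
    fun k m hk => James.sum_abs_initSeq_le n hk m).2

/-- The sum of the indicator functions of the `[0, n)` with `n` in the list `l`. -/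
def initSum (p : ℝ) [Fact (1 < p)] (l : List ℕ) : JamesSpace p := (l.map (initVec p)).sum

theorem initSum_cons (n : ℕ) (l : List ℕ) : initSum p (n :: l) = initVec p n + initSum p l := by
  simp [initSum]

theorem norm_initSum_le (l : List ℕ) : ‖initSum p l‖ ≤ l.length := by
  induction l with
  | nil => simp [initSum]
  | cons n l ih =>
    rw [initSum_cons, List.length_cons]
    push_cast
    linarith [norm_add_le (initVec p n) (initSum p l), norm_initVec_le (p := p) n]

theorem initSum_apply_of_le {l : List ℕ} {N : ℕ} (h : ∀ i ∈ l, i ≤ N) :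
    (initSum p l).toSeq N = 0 := by
  induction l with
  | nil => rfl
  | cons n l ih =>
    rw [initSum_cons, toSeq_add, Pi.add_apply, ih fun i hi => h i (List.mem_cons_of_mem _ hi),
      toSeq_initVec, James.initSeq, if_neg (by simpa using h n List.mem_cons_self), add_zero]

theorem initSum_apply_of_lt {l : List ℕ} {N : ℕ} (h : ∀ i ∈ l, N < i) :
    (initSum p l).toSeq N = l.length := by
  induction l with
  | nil => exact Nat.cast_zero.symm
  | cons n l ih =>
    rw [initSum_cons, toSeq_add, Pi.add_apply, ih fun i hi => h i (List.mem_cons_of_mem _ hi),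
      toSeq_initVec, James.initSeq, if_pos (h n List.mem_cons_self), List.length_cons]
    push_cast
    ring

theorem length_le_norm_initSum_sub {l l' : List ℕ} {N : ℕ} (h : ∀ i ∈ l, i ≤ N)
    (h' : ∀ i ∈ l', N < i) : (l'.length : ℝ) ≤ ‖initSum p l - initSum p l'‖ := by
  have := abs_apply_le (initSum p l - initSum p l') N
  rwa [toSeq_sub, Pi.sub_apply, initSum_apply_of_le h, initSum_apply_of_lt h', zero_sub, abs_neg,
    Nat.abs_cast] at this

theorem varBoundedBy {B : ℝ} {x : JamesSpace p} (h : ‖x‖ ≤ B) :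
    James.VarBoundedBy p B x.toSeq :=
  ⟨fun t => (abs_apply_le x t).trans h, fun _ n hk => (James.pVar_le_jnorm x.mem hk n).trans h⟩

/-- In the induction `a` and `b` carry the partial sums already chosen, `j` counts the pairs placed
so far, and `N` is an index from which `a - b` vanishes. -/
theorem interlacedLE {q : ℝ} [Fact (1 < q)] {f : JamesSpace p → JamesSpace q} {K : ℝ}
    (hK0 : 0 ≤ K) (hK : ∀ x z, ‖f x - f z‖ ≤ K * (‖x - z‖ + 1)) (k : ℕ) :
    ∀ (a b : JamesSpace p) (N j : ℕ),
      (∀ t, -1 ≤ (a - b).toSeq t ∧ (a - b).toSeq t ≤ 0) → (∀ t, N ≤ t → (a - b).toSeq t = 0) →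
      (∀ r n, StrictMono r →
        ∑ i ∈ Finset.range n, |(a - b).toSeq (r (i + 1)) - (a - b).toSeq (r i)| ≤ 2 * j) →
      James.InterlacedLE q (K * ((2 * (j + k : ℕ) : ℝ) ^ (1 / p) + 1)) k
        (fun l => (f (a + initSum p l)).toSeq) (fun l => (f (b + initSum p l)).toSeq) := by
  have hp0 : 0 < p := lt_trans one_pos hp.out
  induction k with
  | zero =>
    intro a b N j h1 _ h3
    have h := (James.jnorm_rpow_le_of_sum_le hp.out
      (fun s t => abs_le.2 ⟨by linarith [(h1 s).1, (h1 t).2], by linarith [(h1 s).2, (h1 t).1]⟩)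
      h3).2
    have h' : ‖a - b‖ ≤ (2 * (j + 0 : ℕ) : ℝ) ^ (1 / p) := by
      rw [one_div, Real.le_rpow_inv_iff_of_pos (norm_nonneg _) (by positivity) hp0]
      rw [add_zero]
      exact h
    have e : initSum p [] = 0 := rfl
    simp only [James.InterlacedLE, e, add_zero, ← toSeq_sub, ← norm_def]
    exact (hK a b).trans (mul_le_mul_of_nonneg_left (add_le_add_left h' 1) hK0)
  | succ k ih =>
    intro a b N j h1 h2 h3
    -- With `N ≤ n < m` the new pair contributes `-1` on `[n, m)`, where `a - b` vanishes; the
    -- values stay in `[-1, 0]` and the variation grows by at most 2.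
    filter_upwards [Nat.hyperfilter_le_atTop (eventually_ge_atTop N)] with n hn
    filter_upwards [Nat.hyperfilter_le_atTop (eventually_gt_atTop n)] with m hm
    have e : ∀ t, ((a + initVec p n) - (b + initVec p m)).toSeq t
        = (a - b).toSeq t + (James.initSeq n t - James.initSeq m t) := fun t => by
      simp only [toSeq_sub, toSeq_add, toSeq_initVec, Pi.sub_apply, Pi.add_apply]
      ring
    have := ih (a + initVec p n) (b + initVec p m) m (j + 1) ?_ ?_ ?_
    · rw [show j + (k + 1) = j + 1 + k by omega]
      simpa only [initSum_cons, add_assoc] using this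
    · intro t
      rw [e]
      rcases lt_or_ge t n with ht | ht
      · simpa [James.initSeq, ht, ht.trans hm] using h1 t
      · rw [h2 t (by omega)]
        simp only [James.initSeq]
        split_ifs <;> first | omega | norm_num
    · intro t ht
      rw [e, h2 t (by omega)]
      simp [James.initSeq, ht.not_gt, (show ¬ t < n by omega)]
    · intro r i hr
      simp only [e]
      have hle : ∀ s t, |(a - b).toSeq s + (James.initSeq n s - James.initSeq m s)
          - ((a - b).toSeq t + (James.initSeq n t - James.initSeq m t))|
          ≤ |(a - b).toSeq s - (a - b).toSeq t| + |James.initSeq n s - James.initSeq n t|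
            + |James.initSeq m s - James.initSeq m t| := fun s t => by
        refine le_trans (le_of_eq ?_) ((abs_sub _ _).trans (add_le_add_left (abs_add_le _ _) _))
        congr 1
        ring
      refine (Finset.sum_le_sum fun i _ => hle (r (i + 1)) (r i)).trans ?_
      rw [Finset.sum_add_distrib, Finset.sum_add_distrib]
      push_cast
      linarith [h3 r i hr, James.sum_abs_initSeq_le n hr i, James.sum_abs_initSeq_le m hr i]

end JamesSpace

/-! ### The contradiction as the length of the lists grows -/

theorem mainTheorem12 (p q : ℝ) [Fact (1 < p)] [Fact (1 < q)] (hpq : q < p) :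
    ¬ ∃ f : JamesSpace p → JamesSpace q, IsCoarseMap f ∧ IsLinearlyExpandingAtRate 1 f := by
  rintro ⟨f, hcoarse, hexp⟩
  have hp1 : 1 < p := Fact.out
  have hq1 : 1 < q := Fact.out
  obtain ⟨K, hK0, hK⟩ := hcoarse.exists_norm_sub_le
  -- For norms at most `k` and distance at least `k`, `L = 1 / 2` only requires `k / 2 + 1 / 2 ≤ k`.
  obtain ⟨C, hC, hexp⟩ := hexp (1 / 2) one_half_pos
  -- This gives `4 * (k * η) = k / (2 * C)`, half of the lower bound `k / C`.
  set η := 1 / (8 * C) with hη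
  have hη0 : 0 < η := by positivity
  -- The factor `2 * K` absorbs the additive 1, as `(2 * k) ^ (1 / p) ≥ 1`.
  set D := 2 * (η ^ (1 - q) * (2 * K) ^ q) with hD
  have key : ∀ k : ℕ, 1 ≤ k →
      1 / (4 * C) ≤ D * (2 * k : ℝ) ^ (-(1 - q / p)) + C * (2 * k : ℝ)⁻¹ := by
    intro k hk
    have hk1 : (1 : ℝ) ≤ k := by exact_mod_cast hk
    have hφ : ∀ l : List ℕ, l.length = k →
        James.VarBoundedBy q (K * (k + 1) + ‖f 0‖) (f (0 + JamesSpace.initSum p l)).toSeq := by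
      intro l hl
      refine JamesSpace.varBoundedBy ?_
      have h1 := JamesSpace.norm_initSum_le (p := p) l
      rw [hl] at h1
      have h2 := hK (0 + JamesSpace.initSum p l) 0
      rw [sub_zero, zero_add] at h2
      rw [zero_add]
      have h3 := mul_le_mul_of_nonneg_left (add_le_add_left h1 1) hK0
      have h4 := norm_sub_norm_le (f (JamesSpace.initSum p l)) (f 0)
      linarith
    have hint := JamesSpace.interlacedLE hK0 hK k 0 0 0 0
      (by simp [JamesSpace.toSeq_zero]) (by simp [JamesSpace.toSeq_zero])
      (by simp [JamesSpace.toSeq_zero])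
    obtain ⟨l, l', N, hl, hl', hlN, hNl, hle⟩ := hint.exists_pair hq1 hη0 hφ
    rw [zero_add, zero_add, ← JamesSpace.toSeq_sub, ← JamesSpace.norm_def] at hle
    have hsep := JamesSpace.length_le_norm_initSum_sub (p := p) hlN hNl
    rw [hl'] at hsep
    have hn1 := JamesSpace.norm_initSum_le (p := p) l
    have hn2 := JamesSpace.norm_initSum_le (p := p) l'
    rw [hl] at hn1
    rw [hl'] at hn2
    have hlow := hexp (JamesSpace.initSum p l) (JamesSpace.initSum p l') (by
      rw [Real.rpow_one, Real.rpow_one]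
      linarith [max_le hn1 hn2])
    have h1 : (k : ℝ) / C ≤ ‖JamesSpace.initSum p l - JamesSpace.initSum p l'‖ / C :=
      div_le_div_of_nonneg_right hsep hC.le
    have h2k : (1 : ℝ) ≤ (2 * k : ℝ) ^ (1 / p) :=
      Real.one_le_rpow (by linarith) (by positivity)
    have h2 : (K * ((2 * (0 + k : ℕ) : ℝ) ^ (1 / p) + 1)) ^ q
        ≤ (2 * K) ^ q * (2 * k : ℝ) ^ (q / p) := by
      calc _ ≤ (2 * K * (2 * k : ℝ) ^ (1 / p)) ^ q := by
            refine Real.rpow_le_rpow (by positivity) ?_ (by linarith)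
            rw [zero_add]
            nlinarith
        _ = _ := by
            rw [Real.mul_rpow (by positivity) (by positivity), ← Real.rpow_mul (by positivity),
              one_div_mul_eq_div]
    have h3 := mul_le_mul_of_nonneg_left h2 (Real.rpow_nonneg hη0.le (1 - q))
    have h4 : (k : ℝ) / C - C ≤ 4 * (k * η) + D * (2 * k : ℝ) ^ (q / p) := by
      rw [hD]
      linarith
    have h5 : (k : ℝ) / C - 4 * (k * η) = (2 * k) * (1 / (4 * C)) := by
      rw [hη]
      field_simp
      norm_num
    have h6 : (2 * k : ℝ) ^ (q / p) = 2 * k * (2 * k : ℝ) ^ (-(1 - q / p)) := by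
      rw [← Real.rpow_one_add' (by positivity)]
      · congr 1
        ring
      · have : 0 < q / p := by positivity
        linarith
    refine le_of_mul_le_mul_left ?_ (show (0 : ℝ) < 2 * k by linarith)
    rw [h6] at h4
    have h7 : (2 * k : ℝ) * (C * (2 * k : ℝ)⁻¹) = C := by
      field_simp
    rw [mul_add, h7]
    linarith
  have hlim : Tendsto (fun k : ℕ => D * (2 * k : ℝ) ^ (-(1 - q / p)) + C * (2 * k : ℝ)⁻¹) atTop
      (𝓝 (D * 0 + C * 0)) := by
    have h2 : Tendsto (fun k : ℕ => (2 * k : ℝ)) atTop atTop :=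
      tendsto_natCast_atTop_atTop.const_mul_atTop two_pos
    have hqp : 0 < 1 - q / p := sub_pos.2 ((div_lt_one (by linarith)).2 hpq)
    exact (((tendsto_rpow_neg_atTop hqp).comp h2).const_mul D).add
      ((tendsto_inv_atTop_zero.comp h2).const_mul C)
  rw [mul_zero, mul_zero, add_zero] at hlim
  obtain ⟨k, hk, hk1⟩ := ((hlim.eventually (gt_mem_nhds (show 0 < 1 / (4 * C) by positivity))).and
    (eventually_ge_atTop 1)).exists
  linarith [key k hk1]
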